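/- For a finite simple graph $G$ with adjacency matrix $A(G)$ and diagonal matrix of vertex degrees $D(G)$, let $q(G)$ denote the largest eigenvalue of the signless Laplacian $Q(G)=D(G)+A(G)$. For $n\ge 2$ let $S_{n,2}=K_2\vee\overline{K}_{n-2}$ be the graph of order $n$ obtained by joining each vertex of a complete graph of order $2$ to each vertex of an independent set of order $n-2$. Let $n\ge 6$ and let $G$ be a graph of order $n$ that contains no cycle $C_5$ of length $5$ as a (not necessarily induced) subgraph. If $G$ has a vertex of degree $n-1$, then \[ q(G)<q(S_{n,2}), \] unless $G$ is isomorphic to $S_{n,2}$. -/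

import Mathlib

namespace SimpleGraph

/-- The signless Laplacian `Q(G) = D(G) + A(G)`: degree matrix plus adjacency matrix. -/
def signlessLaplacian {V : Type*} [Fintype V] [DecidableEq V] (G : SimpleGraph V)
    [DecidableRel G.Adj] : Matrix V V ℝ :=
  G.degMatrix ℝ + G.adjMatrix ℝ

open Classical in
/-- The `Q`-index `q(G)`: the largest eigenvalue of the signless Laplacian of `G`.
For a nonempty vertex set the supremum is a maximum, see `isGreatest_qIndex`. -/
noncomputable def qIndex {V : Type*} [Fintype V] (G : SimpleGraph V) : ℝ :=
  sSup (spectrum ℝ G.signlessLaplacian)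

theorem isHermitian_signlessLaplacian {V : Type*} [Fintype V] [DecidableEq V]
    (G : SimpleGraph V) [DecidableRel G.Adj] : G.signlessLaplacian.IsHermitian :=
  (G.isHermitian_degMatrix ℝ).add (G.isHermitian_adjMatrix ℝ)

theorem isGreatest_qIndex {V : Type*} [Fintype V] [Nonempty V] [DecidableEq V]
    (G : SimpleGraph V) [DecidableRel G.Adj] :
    IsGreatest (spectrum ℝ G.signlessLaplacian) G.qIndex := by
  have h : G.qIndex = sSup (spectrum ℝ G.signlessLaplacian) := by
    unfold qIndex
    congr!
  have hs := G.isHermitian_signlessLaplacian.spectrum_real_eq_range_eigenvalues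
  rw [h, hs]
  exact ⟨(Set.range_nonempty _).csSup_mem (Set.finite_range _),
    fun _ hx => le_csSup (Set.finite_range _).bddAbove hx⟩

/-- The join `G ∨ H`: the disjoint union of `G` and `H` together with all edges between them. -/
def join {V W : Type*} (G : SimpleGraph V) (H : SimpleGraph W) : SimpleGraph (V ⊕ W) :=
  (G ⊕g H) ⊔ completeBipartiteGraph V W

/-- `S_{n,k} = K_k ∨ (complement of K_{n-k})`, for `k ≤ n`: the join of a complete graph of
order `k` and an independent set of order `n - k`. -/
def completeSplit (n k : ℕ) : SimpleGraph (Fin k ⊕ Fin (n - k)) :=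
  join (⊤ : SimpleGraph (Fin k)) (⊥ : SimpleGraph (Fin (n - k)))

end SimpleGraph

namespace SimpleGraph

variable {V : Type*}

/-! Let `w` be a dominating vertex and `H` the graph `G` with the edges at `w` removed. Without a
`C₅`, every edge of `H` has an endpoint of `H`-degree 1 or both endpoints of `H`-degree 2. A second
dominating vertex therefore forces `S_{n,2}`. Otherwise the `H`-degrees along an edge sum to at most
`n - 2`, and all of them sum to at most `2n`. Let `q` be the larger root of `q² - (n+2)q + 4`, an
eigenvalue of `Q(S_{n,2})`. These two bounds make an explicit positive vector, affine in the
`H`-degree off `w`, a supersolution of `Q(G) z ≤ q z` that is strict at `w`. Comparison with an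
eigenvector then gives `q(G) < q`. -/

/-- Entrywise form of the action of the signless Laplacian on a vector. -/
theorem signlessLaplacian_mulVec_apply [Fintype V] [DecidableEq V] (G : SimpleGraph V)
    [DecidableRel G.Adj] (x : V → ℝ) (v : V) :
    (G.signlessLaplacian.mulVec x) v = G.degree v * x v + ∑ u ∈ G.neighborFinset v, x u := by
  simp [signlessLaplacian, Matrix.add_mulVec, degMatrix, Matrix.mulVec_diagonal,
    adjMatrix_mulVec_apply]

theorem mem_spectrum_of_mulVec_eq [Fintype V] [DecidableEq V] {A : Matrix V V ℝ} {μ : ℝ}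
    {x : V → ℝ} (hx : x ≠ 0) (h : A.mulVec x = μ • x) : μ ∈ spectrum ℝ A := by
  rw [← Matrix.spectrum_toLin', ← Module.End.hasEigenvalue_iff_mem_spectrum]
  exact Module.End.hasEigenvalue_of_hasEigenvector
    (Module.End.hasEigenvector_iff.2 ⟨Module.End.mem_eigenspace_iff.2 (by simpa using h), hx⟩)

theorem exists_mulVec_eq_of_mem_spectrum [Fintype V] [DecidableEq V] {A : Matrix V V ℝ} {μ : ℝ}
    (h : μ ∈ spectrum ℝ A) : ∃ x : V → ℝ, x ≠ 0 ∧ A.mulVec x = μ • x := by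
  rw [← Matrix.spectrum_toLin', ← Module.End.hasEigenvalue_iff_mem_spectrum] at h
  obtain ⟨x, hx⟩ := h.exists_hasEigenvector
  exact ⟨x, hx.2, by simpa using hx.apply_eq_smul⟩

theorem le_qIndex_of_mulVec_eq [Fintype V] [DecidableEq V] (G : SimpleGraph V)
    [DecidableRel G.Adj] {μ : ℝ} {x : V → ℝ} (hx : x ≠ 0)
    (h : G.signlessLaplacian.mulVec x = μ • x) : μ ≤ G.qIndex := by
  obtain ⟨v, -⟩ := Function.ne_iff.1 hx
  have : Nonempty V := ⟨v⟩
  exact G.isGreatest_qIndex.2 (mem_spectrum_of_mulVec_eq hx h)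

/-- A positive vector `z` with `Q(G) z ≤ q z`, strict at a dominating vertex, forces
`q(G) < q`. -/
theorem qIndex_lt_of_supersolution [Fintype V] (G : SimpleGraph V) [DecidableRel G.Adj]
    {q : ℝ} {z : V → ℝ} (hz : ∀ v, 0 < z v)
    (hle : ∀ v, G.degree v * z v + ∑ u ∈ G.neighborFinset v, z u ≤ q * z v)
    {w : V} (hw : ∀ v, v ≠ w → G.Adj v w)
    (hlt : G.degree w * z w + ∑ u ∈ G.neighborFinset w, z u < q * z w) : G.qIndex < q := by
  classical
  have : Nonempty V := ⟨w⟩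
  by_contra! hq
  obtain ⟨x, hx0, hx⟩ := exists_mulVec_eq_of_mem_spectrum G.isGreatest_qIndex.1
  have hsub (v : V) :
      q * |x v| ≤ G.degree v * |x v| + ∑ u ∈ G.neighborFinset v, |x u| := by
    have h := congrFun hx v
    rw [signlessLaplacian_mulVec_apply, Pi.smul_apply, smul_eq_mul] at h
    calc q * |x v| ≤ G.qIndex * |x v| := by gcongr
      _ ≤ |G.qIndex * x v| := by
        rw [abs_mul]; gcongr; exact le_abs_self _
      _ = |G.degree v * x v + ∑ u ∈ G.neighborFinset v, x u| := by rw [h]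
      _ ≤ |G.degree v * x v| + |∑ u ∈ G.neighborFinset v, x u| := abs_add_le _ _
      _ ≤ _ := by
        rw [abs_mul, Nat.abs_cast]; gcongr; exact Finset.abs_sum_le_sum_abs _ _
  -- Scale `z` to touch `|x|` from above at `v`. Contact at `w` contradicts strictness there;
  -- contact elsewhere fails because `w` is a neighbour of `v`.
  obtain ⟨v, hv⟩ := Finite.exists_max fun v => |x v| / z v
  set r := |x v| / z v with hr
  have hxr (u : V) : |x u| ≤ r * z u := (div_le_iff₀ (hz u)).1 (hv u)
  have hxv : |x v| = r * z v := by rw [hr, div_mul_cancel₀ _ (hz v).ne']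
  have hr0 : 0 < r := by
    obtain ⟨u, hu⟩ := Function.ne_iff.1 hx0
    exact (div_pos (abs_pos.2 hu) (hz u)).trans_le (hv u)
  have hsum (u : V) :
      ∑ t ∈ G.neighborFinset u, |x t| ≤ r * ∑ t ∈ G.neighborFinset u, z t := by
    rw [Finset.mul_sum]; exact Finset.sum_le_sum fun t _ => hxr t
  have hwlt : |x w| < r * z w := by
    refine (hxr w).lt_of_ne fun h => ?_
    have h1 := hsub w
    rw [h] at h1
    nlinarith [hsum w]
  have hvw : v ≠ w := by rintro rfl; exact hwlt.ne hxv
  have hstrict : ∑ t ∈ G.neighborFinset v, |x t| < r * ∑ t ∈ G.neighborFinset v, z t := by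
    rw [Finset.mul_sum]
    exact Finset.sum_lt_sum (fun t _ => hxr t)
      ⟨w, (G.mem_neighborFinset _ _).2 (hw v hvw), hwlt⟩
  have h1 := hsub v
  rw [hxv] at h1
  nlinarith [hle v]

/-- Adjacency in `K_k ∨ (complement of K_{n-k})`. -/
theorem completeSplit_adj {n k : ℕ} (a b : Fin k ⊕ Fin (n - k)) :
    (completeSplit n k).Adj a b ↔ a ≠ b ∧ (a.isLeft ∨ b.isLeft) := by
  rcases a with a | a <;> rcases b with b | b <;> simp [completeSplit, join]

/-- Each root of `q² - (n+2) q + 4` is an eigenvalue of `Q(S_{n,2})`. -/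
theorem le_qIndex_completeSplit_two {n : ℕ} (hn : 3 ≤ n) {q : ℝ}
    (hq : q ^ 2 - (n + 2) * q + 4 = 0) : q ≤ (completeSplit n 2).qIndex := by
  classical
  have hcast : ((n - 2 : ℕ) : ℝ) = n - 2 := by
    rw [Nat.cast_sub (by omega)]; norm_num
  -- The eigen-equation on the independent side fixes the ratio `(q - 2) : 2`; on the clique side it
  -- becomes `hq`.
  refine le_qIndex_of_mulVec_eq (x := Sum.elim (fun _ => q - 2) (fun _ => 2)) _ ?_ ?_
  · intro h
    simpa using congrFun h (Sum.inr ⟨0, by omega⟩)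
  · ext v
    rw [signlessLaplacian_mulVec_apply, ← card_neighborFinset_eq_degree, Finset.card_eq_sum_ones]
    simp only [neighborFinset_eq_filter, Finset.sum_filter, completeSplit_adj,
      Fintype.sum_sum_type, Pi.smul_apply, smul_eq_mul]
    rcases v with v | v
    · fin_cases v <;> simp [Fin.sum_univ_two, hcast] <;> linear_combination -hq
    · simp; ring

/-- A graph whose edges are exactly those meeting `{w, u}` is `S_{n,2}`. -/
theorem nonempty_iso_completeSplit_two [Fintype V] (G : SimpleGraph V) {w u : V} (hwu : w ≠ u)
    (hG : ∀ a b, G.Adj a b ↔ a ≠ b ∧ ((a = w ∨ a = u) ∨ (b = w ∨ b = u))) :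
    Nonempty (G ≃g completeSplit (Fintype.card V) 2) := by
  classical
  let p : V → Prop := fun v => v = w ∨ v = u
  have hp : Fintype.card {v // p v} = 2 := by
    rw [Fintype.card_subtype, ← Finset.card_pair hwu]
    congr 1
    ext; simp [p]
  have hp' : Fintype.card {v // ¬ p v} = Fintype.card V - 2 := by
    rw [Fintype.card_subtype_compl, hp]
  let e : V ≃ Fin 2 ⊕ Fin (Fintype.card V - 2) :=
    (Equiv.sumCompl p).symm.trans
      (Equiv.sumCongr (Fintype.equivFinOfCardEq hp) (Fintype.equivFinOfCardEq hp'))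
  have he (v : V) : (e v).isLeft ↔ p v := by
    by_cases h : p v
    · simp [e, h, Equiv.sumCompl_symm_apply_of_pos]
    · simp [e, h, Equiv.sumCompl_symm_apply_of_neg]
  exact ⟨⟨e, by intro a b; rw [completeSplit_adj, hG, he, he, e.injective.ne_iff]⟩⟩

/-- Only the five diagonals need distinctness hypotheses; the sides are distinct by adjacency. -/
theorem not_free_cycleGraph_five (G : SimpleGraph V) {w x u v y : V}
    (h1 : G.Adj w x) (h2 : G.Adj x u) (h3 : G.Adj u v) (h4 : G.Adj v y) (h5 : G.Adj y w)
    (hwu : w ≠ u) (hwv : w ≠ v) (hxv : x ≠ v) (hxy : x ≠ y) (huy : u ≠ y) :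
    ¬ (cycleGraph 5).Free G := by
  rw [Free, not_not]
  refine ⟨⟨⟨![w, x, u, v, y], ?_⟩, ?_⟩⟩
  · intro a b hab
    rw [cycleGraph_adj'] at hab
    fin_cases a <;> fin_cases b <;> simp_all [G.adj_comm] <;> exact absurd hab (by decide)
  · intro a b hab
    have := h1.ne; have := h2.ne; have := h3.ne; have := h4.ne; have := h5.ne
    fin_cases a <;> fin_cases b <;> simp_all

/-- In a `C₅`-free graph with dominating vertex `w`, an edge `uv` off `w` has an endpoint of
degree at most two, or both endpoints of degree at most three. -/
theorem degree_le_of_adj_of_free [Fintype V] (G : SimpleGraph V) [DecidableRel G.Adj]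
    (hC5 : (cycleGraph 5).Free G) {w : V} (hw : ∀ v, v ≠ w → G.Adj v w) {u v : V}
    (hu : u ≠ w) (hv : v ≠ w) (huv : G.Adj u v) (hdu : 3 ≤ G.degree u) : G.degree v ≤ 3 := by
  classical
  by_contra! hdv
  -- Choose `x`, then `y`, to close the 5-cycle `w x u v y` through the dominating vertex.
  obtain ⟨x, hx, hx'⟩ := Finset.exists_mem_notMem_of_card_lt_card (s := {w, v})
    (t := G.neighborFinset u)
    (by rw [card_neighborFinset_eq_degree]; exact Finset.card_le_two.trans_lt hdu)
  obtain ⟨y, hy, hy'⟩ := Finset.exists_mem_notMem_of_card_lt_card (s := {w, u, x})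
    (t := G.neighborFinset v)
    (by rw [card_neighborFinset_eq_degree]; exact Finset.card_le_three.trans_lt hdv)
  simp only [mem_neighborFinset, Finset.mem_insert, Finset.mem_singleton, not_or] at hx hx' hy hy'
  exact G.not_free_cycleGraph_five (hw x hx'.1).symm hx.symm huv hy (hw y hy'.1) hu.symm hv.symm
    hx'.2 (Ne.symm hy'.2.2) (Ne.symm hy'.2.1) hC5

/-- If `1 ≤ 1 / d u + 1 / d v` along every edge, then twice the number of edges is at most twice
the number of vertices. -/
theorem sum_degree_le_two_mul_card [Fintype V] (G : SimpleGraph V) [DecidableRel G.Adj]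
    (h : ∀ u v, G.Adj u v → (1 : ℝ) ≤ (G.degree u : ℝ)⁻¹ + (G.degree v : ℝ)⁻¹) :
    ∑ v, (G.degree v : ℝ) ≤ 2 * Fintype.card V := by
  classical
  have hdiv (v : V) : (G.degree v : ℝ) * (G.degree v : ℝ)⁻¹ ≤ 1 := mul_inv_le_one
  have hswap : ∑ u, ∑ v ∈ G.neighborFinset u, (G.degree v : ℝ)⁻¹ =
      ∑ u, ∑ v ∈ G.neighborFinset u, (G.degree u : ℝ)⁻¹ :=
    Finset.sum_comm' fun u v => by simp [G.adj_comm]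
  calc ∑ u, (G.degree u : ℝ) = ∑ u, ∑ v ∈ G.neighborFinset u, (1 : ℝ) := by simp
    _ ≤ ∑ u, ∑ v ∈ G.neighborFinset u, ((G.degree u : ℝ)⁻¹ + (G.degree v : ℝ)⁻¹) :=
        Finset.sum_le_sum fun u _ => Finset.sum_le_sum fun v hv =>
          h u v ((G.mem_neighborFinset _ _).1 hv)
    _ = 2 * ∑ u, (G.degree u : ℝ) * (G.degree u : ℝ)⁻¹ := by
        simp_rw [Finset.sum_add_distrib, hswap]
        simp [two_mul]
    _ ≤ 2 * ∑ _u : V, (1 : ℝ) := by gcongr with u; exact hdiv u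
    _ = 2 * Fintype.card V := by simp

theorem neighborFinset_eq_insert_of_dominating [Fintype V] [DecidableEq V] (G : SimpleGraph V)
    [DecidableRel G.Adj] {w u : V}
    (hw : ∀ v, v ≠ w → G.Adj v w) (hu : u ≠ w) :
    G.neighborFinset u = insert w ((G.deleteIncidenceSet w).neighborFinset u) := by
  ext v
  by_cases hv : v = w
  · simp [hv, hw u hu]
  · simp [deleteIncidenceSet_adj, hu, hv]

theorem degree_eq_deleteIncidenceSet_add_one [Fintype V] [DecidableEq V] (G : SimpleGraph V)
    [DecidableRel G.Adj] {w u : V}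
    (hw : ∀ v, v ≠ w → G.Adj v w) (hu : u ≠ w) :
    G.degree u = (G.deleteIncidenceSet w).degree u + 1 := by
  rw [← card_neighborFinset_eq_degree, neighborFinset_eq_insert_of_dominating G hw hu,
    Finset.card_insert_of_notMem (by simp [deleteIncidenceSet_adj]),
    card_neighborFinset_eq_degree]

theorem adj_of_degree_eq_card_sub_one [Fintype V] (G : SimpleGraph V) [DecidableRel G.Adj] {w : V}
    (h : G.degree w = Fintype.card V - 1) {v : V} (hv : v ≠ w) : G.Adj v w := by
  classical
  have hN : G.neighborFinset w = Finset.univ.erase w := by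
    refine Finset.eq_of_subset_of_card_le (fun x hx => ?_) ?_
    · simpa using ((G.mem_neighborFinset _ _).1 hx).ne'
    · simp [h]
  have : v ∈ G.neighborFinset w := by simp [hN, hv]
  exact ((G.mem_neighborFinset _ _).1 this).symm

/-- A `C₅`-free graph of order at least six with two dominating vertices is `S_{n,2}`. -/
theorem nonempty_iso_completeSplit_two_of_free [Fintype V] (G : SimpleGraph V)
    [DecidableRel G.Adj] (hn : 6 ≤ Fintype.card V) (hC5 : (cycleGraph 5).Free G) {w u : V}
    (hwu : w ≠ u) (hw : G.degree w = Fintype.card V - 1) (hu : G.degree u = Fintype.card V - 1) :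
    Nonempty (G ≃g completeSplit (Fintype.card V) 2) := by
  classical
  have hw' (v : V) (hv : v ≠ w) : G.Adj v w := adj_of_degree_eq_card_sub_one G hw hv
  have hu' (v : V) (hv : v ≠ u) : G.Adj v u := adj_of_degree_eq_card_sub_one G hu hv
  refine nonempty_iso_completeSplit_two G hwu fun a b => ⟨fun h => ⟨h.ne, ?_⟩, ?_⟩
  · by_contra! hab
    obtain ⟨⟨haw, hau⟩, hbw, hbu⟩ := hab
    -- An edge `ab` avoiding `w` and `u` gives `a` three neighbours, which caps the degree of `u` at
    -- 3, below `n - 1`.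
    have h3 : 3 ≤ G.degree a := by
      rw [← card_neighborFinset_eq_degree,
        ← Finset.card_eq_three.2 ⟨w, u, b, hwu, hbw.symm, hbu.symm, rfl⟩]
      refine Finset.card_le_card fun x hx => ?_
      simp only [Finset.mem_insert, Finset.mem_singleton] at hx
      rcases hx with rfl | rfl | rfl <;> simp [h, hw', hu', haw, hau]
    have := G.degree_le_of_adj_of_free hC5 hw' haw hwu.symm (hu' a hau) h3
    omega
  · rintro ⟨hab, (rfl | rfl) | (rfl | rfl)⟩
    exacts [(hw' b hab.symm).symm, (hu' b hab.symm).symm, hw' a hab, hu' a hab]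

/-- A `C₅`-free graph with exactly one dominating vertex has `q(G) < q` for every root `q ≥ n` of
`q² - (n+2) q + 4`. -/
theorem qIndex_lt_of_free [Fintype V] (G : SimpleGraph V) [DecidableRel G.Adj]
    (hn : 6 ≤ Fintype.card V) (hC5 : (cycleGraph 5).Free G) {w : V}
    (hw : G.degree w = Fintype.card V - 1)
    (huniq : ∀ u, u ≠ w → G.degree u ≠ Fintype.card V - 1) {q : ℝ}
    (hqn : (Fintype.card V : ℝ) < q)
    (hq : q ^ 2 - (Fintype.card V + 2) * q + 4 = 0) : G.qIndex < q := by
  classical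
  have hw' (v : V) (hv : v ≠ w) : G.Adj v w := adj_of_degree_eq_card_sub_one G hw hv
  set n := Fintype.card V
  set H := G.deleteIncidenceSet w with hH
  have hdeg (u : V) (hu : u ≠ w) : G.degree u = H.degree u + 1 :=
    degree_eq_deleteIncidenceSet_add_one G hw' hu
  have hN (u : V) (hu : u ≠ w) : G.neighborFinset u = insert w (H.neighborFinset u) :=
    neighborFinset_eq_insert_of_dominating G hw' hu
  have hHw (u : V) : w ∉ H.neighborFinset u := by simp [hH, deleteIncidenceSet_adj]
  have hHmax (u : V) (hu : u ≠ w) : H.degree u + 3 ≤ n := by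
    have h1 := hdeg u hu
    have h2 := huniq u hu
    have h3 := G.degree_lt_card_verts u
    omega
  have hHadj (u v : V) (huv : H.Adj u v) : u ≠ w ∧ v ≠ w ∧ G.Adj u v := by
    rw [hH, deleteIncidenceSet_adj] at huv
    exact ⟨huv.2.1, huv.2.2, huv.1⟩
  have hedge (u v : V) (huv : H.Adj u v) :
      1 ≤ H.degree u ∧ 1 ≤ H.degree v ∧
        (H.degree u = 1 ∨ H.degree v = 1 ∨ H.degree u = 2 ∧ H.degree v = 2) := by
    obtain ⟨hu, hv, h⟩ := hHadj u v huv
    have h1 : 0 < H.degree u := (H.degree_pos_iff_exists_adj u).2 ⟨v, huv⟩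
    have h2 : 0 < H.degree v := (H.degree_pos_iff_exists_adj v).2 ⟨u, huv.symm⟩
    have h3 := G.degree_le_of_adj_of_free hC5 hw' hu hv h
    have h4 := G.degree_le_of_adj_of_free hC5 hw' hv hu h.symm
    rw [hdeg u hu, hdeg v hv] at h3 h4
    omega
  -- Either `1 + (n - 3)`, as no vertex but `w` dominates, or `2 + 2`, where `n ≥ 6` is needed.
  have hedgesum (u v : V) (huv : H.Adj u v) : (H.degree u + H.degree v : ℝ) ≤ n - 2 := by
    obtain ⟨hu, hv, -⟩ := hHadj u v huv
    have h1 := hedge u v huv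
    have h2 := hHmax u hu
    have h3 := hHmax v hv
    have : H.degree u + H.degree v + 2 ≤ n := by omega
    have : (H.degree u + H.degree v + 2 : ℝ) ≤ n := by exact_mod_cast this
    linarith
  have htotal : ∑ v, (H.degree v : ℝ) ≤ 2 * n := by
    refine H.sum_degree_le_two_mul_card fun u v huv => ?_
    obtain ⟨-, -, h | h | h⟩ := hedge u v huv
    · simp [h]
    · simp [h]
    · norm_num [h.1, h.2]
  have hn' : (6 : ℝ) ≤ n := by exact_mod_cast hn
  -- With this `b`, the inequality at `u ≠ w` reduces exactly to `hedgesum` summed over the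
  -- `H`-neighbours of `u`.
  set b := q - n + 1 with hb
  have hb0 : 0 < b := by linarith
  let z : V → ℝ := fun v => if v = w then (q - 1) * b else b + 2 * H.degree v
  have hzw : z w = (q - 1) * b := if_pos rfl
  have hzu (u : V) (hu : u ≠ w) : z u = b + 2 * H.degree u := if_neg hu
  have hstrict : G.degree w * z w + ∑ u ∈ G.neighborFinset w, z u < q * z w := by
    have hNw : G.neighborFinset w = Finset.univ.erase w := by
      ext v
      by_cases hv : v = w
      · simp [hv]
      · simp [hv, (hw' v hv).symm]
    have hsum : ∑ u ∈ G.neighborFinset w, z u ≤ (n - 1) * b + 4 * n := by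
      have hcard : ((Finset.univ.erase w).card : ℝ) = n - 1 := by
        rw [Finset.card_erase_of_mem (Finset.mem_univ w), Finset.card_univ,
          Nat.cast_sub (by omega)]
        simp [n]
      rw [hNw, Finset.sum_congr rfl fun u hu => hzu u (Finset.ne_of_mem_erase hu),
        Finset.sum_add_distrib, Finset.sum_const, nsmul_eq_mul, hcard, ← Finset.mul_sum]
      have : ∑ u ∈ Finset.univ.erase w, (H.degree u : ℝ) ≤ ∑ u, (H.degree u : ℝ) :=
        Finset.sum_le_sum_of_subset_of_nonneg (Finset.erase_subset _ _)
          fun _ _ _ => by positivity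
      linarith
    have hdw : (G.degree w : ℝ) = n - 1 := by
      rw [hw, Nat.cast_sub (by omega)]; simp
    -- The slack at `w` is at least `2q - 12`, positive since `q > n ≥ 6`.
    have hid : (q - 1) * b ^ 2 - (n - 1) * b - 4 * n = 2 * q - 12 := by
      linear_combination (q - n + 3) * hq
    rw [hzw, hdw]
    nlinarith
  refine G.qIndex_lt_of_supersolution (z := z) (fun v => ?_) (fun u => ?_) hw' hstrict
  · by_cases hv : v = w
    · rw [hv, hzw]
      exact mul_pos (by linarith) hb0
    · rw [hzu v hv]
      positivity
  · by_cases hu : u = w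
    · rw [hu]; exact hstrict.le
    · have hle : ∑ v ∈ H.neighborFinset u, (H.degree u + H.degree v : ℝ) ≤
          ∑ v ∈ H.neighborFinset u, ((n : ℝ) - 2) :=
        Finset.sum_le_sum fun v hv => hedgesum u v ((H.mem_neighborFinset _ _).1 hv)
      have hsum : ∑ v ∈ H.neighborFinset u, z v =
          ∑ v ∈ H.neighborFinset u, (b + 2 * H.degree v) :=
        Finset.sum_congr rfl fun v hv => hzu v fun h => hHw u (h ▸ hv)
      rw [hN u hu, Finset.sum_insert (hHw u), hsum, hdeg u hu, hzw, hzu u hu]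
      simp only [Finset.sum_add_distrib, Finset.sum_const, nsmul_eq_mul, ← Finset.mul_sum,
        card_neighborFinset_eq_degree] at hle ⊢
      push_cast
      have hqb : q = b + n - 1 := by rw [hb]; ring
      rw [hqb]
      nlinarith

end SimpleGraph

theorem mainTheorem4 {V : Type*} [Fintype V] (G : SimpleGraph V) [DecidableRel G.Adj]
    (n : ℕ) (hn : 6 ≤ n) (hcard : Fintype.card V = n)
    (hC5 : (SimpleGraph.cycleGraph 5).Free G)
    (hdeg : ∃ v : V, G.degree v = n - 1)
    (hne : ¬ Nonempty (G ≃g SimpleGraph.completeSplit n 2)) :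
    G.qIndex < (SimpleGraph.completeSplit n 2).qIndex := by
  subst hcard
  obtain ⟨w, hw⟩ := hdeg
  have hn' : (6 : ℝ) ≤ Fintype.card V := by exact_mod_cast hn
  set N : ℝ := (Fintype.card V : ℝ) with hN
  have hD : 0 ≤ (N + 2) ^ 2 - 16 := by nlinarith
  set s := √((N + 2) ^ 2 - 16) with hs
  have hs2 : s ^ 2 = (N + 2) ^ 2 - 16 := Real.sq_sqrt hD
  -- This says that the larger root exceeds `N`.
  have hsN : N - 2 < s := Real.lt_sqrt_of_sq_lt (by nlinarith)
  have hq : ((N + 2 + s) / 2) ^ 2 - (N + 2) * ((N + 2 + s) / 2) + 4 = 0 := by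
    linear_combination hs2 / 4
  refine (G.qIndex_lt_of_free hn hC5 hw (fun u hu hdu => hne ?_) ?_ hq).trans_le
    (SimpleGraph.le_qIndex_completeSplit_two (by omega) hq)
  · exact G.nonempty_iso_completeSplit_two_of_free hn hC5 hu.symm hw hdu
  · rw [← hN]; linarith
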